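/- Fix integers $k\ge 1$ and $n>k$. An instance $I\in\mathcal I_{k,n}$ consists of an integer $m\ge1$, valuations $r_1\ge\cdots\ge r_m\ge 0$, and probabilities $p_{ij}\ge 0$ with $\sum_{j=1}^m p_{ij}=1$ for each $i\in[n]$. Agents $i=1,\dots,n$ arrive in this order; agent $i$ has, independently of the others, type $j$ with probability $p_{ij}$, and then valuation $R_i=r_j$. At most $k$ agents can be accepted. Let $\mathsf{DP}(I)$ be the largest expected sum of valuations of accepted agents over all online policies (agent $i$ is irrevocably accepted or rejected on arrival, knowing $I$ and the types of agents $1,\dots,i$ only); let $$\mathsf{Proph}(I)=\mathbb E\Big[\max_{S\subseteq[n],\,|S|\le k}\ \sum_{i\in S}R_i\Big],\qquad \mathsf{ExAnte}(I)=\max\Big\{\sum_{j=1}^m r_ja_j:\ \sum_{j=1}^m a_j\le k,\ 0\le a_j\le\sum_{i=1}^n p_{ij}\ \ \forall j\in[m]\Big\}.$$ Let $\mathbf G$ range over all choices of an integer $m\ge1$ and reals $0\le G_{i1}\le\cdots\le G_{im}=1$ for $i\in[n]$. For coefficients $(Q_j)_{j\in[m]}$ consider the simplified Type Coverage dual in the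 variables $\theta$, $x^l_i$, $y^l_i$ ($i\in[n]$, $l\in[k]$): $$\begin{aligned}\max\ &\theta\\ \text{s.t. }&\theta\, Q_j\le\sum_{i=1}^n\sum_{l=1}^k\min\{y^l_i,\,G_{ij}x^l_i\}&&\forall j\in[m],\\ &0\le y^l_i\le x^l_i&&\forall i\in[n],\,l\in[k],\\ &x^k_1=1,\quad x^l_1=0&&\forall l<k,\\ &x^l_i=x^l_{i-1}-y^l_{i-1}+y^{l+1}_{i-1}&&\forall\, 1<i\le n,\ l\in[k],\end{aligned}$$ where $y^{k+1}_i:=0$. Let $\mathrm{innerLP}^{\mathsf{DP}/\mathsf{Proph}}_{k,n}(\mathbf G)$ be its optimal value for $Q_j=\mathbb E[\min\{\sum_{i=1}^n\mathrm{Ber}(G_{ij}),k\}]$, with independent Bernoulli variables $\mathrm{Ber}(G_{ij})$, $i\in[n]$, of means $G_{ij}$, and let $\mathrm{innerLP}^{\mathsf{DP}/\mathsf{ExAnte}}_{k,n}(\mathbf G)$ be its optimal value for $Q_j=\min\{\sum_{i=1}^n G_{ij},k\}$. Then both maxima are attained for every $\mathbf G$, and $$\inf_{I}\frac{\mathsf{DP}(I)}{\mathsf{Proph}(I)}=\inf_{\mathbf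 G}\ \mathrm{innerLP}^{\mathsf{DP}/\mathsf{Proph}}_{k,n}(\mathbf G),\qquad \inf_{I}\frac{\mathsf{DP}(I)}{\mathsf{ExAnte}(I)}=\inf_{\mathbf G}\ \mathrm{innerLP}^{\mathsf{DP}/\mathsf{ExAnte}}_{k,n}(\mathbf G),$$ where the infima on the left are over those $I\in\mathcal I_{k,n}$ for which the denominator is positive (all four infima are finite). -/

import Mathlib

open Finset

noncomputable section

namespace ProphetIneq

/-- An instance with `k` slots and `n` agents: `m` types with valuations
`r 0 ≥ r 1 ≥ ⋯ ≥ 0`, and the probability `p i j` that agent `i` has type `j`.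
(Indices start at `0`, so type `0` is the best one and agent `0` arrives first.) -/
structure Instance (k n : ℕ) where
  m : ℕ
  r : Fin m → ℝ
  r_antitone : Antitone r
  r_nonneg : ∀ j, 0 ≤ r j
  p : Fin n → Fin m → ℝ
  p_nonneg : ∀ i j, 0 ≤ p i j
  p_sum : ∀ i, ∑ j, p i j = 1

namespace Instance

variable {k n : ℕ} (I : Instance k n)

/-- Expectation of `f` over the independent types `ω 0, …, ω (n - 1)` of the agents. -/
def expect (f : (Fin n → Fin I.m) → ℝ) : ℝ :=
  ∑ ω : Fin n → Fin I.m, (∏ i, I.p i (ω i)) * f ω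

/-- The prophet's performance: the expected maximum of `∑ i ∈ S, R_i` over sets `S` of at
most `k` agents. -/
def Proph : ℝ :=
  I.expect fun ω =>
    ((univ : Finset (Finset (Fin n))).filter fun S => S.card ≤ k).sup' ⟨∅, by simp⟩
      fun S => ∑ i ∈ S, I.r (ω i)

/-- The values of the feasible solutions of the ex-ante linear program. -/
def exAnteValues : Set ℝ :=
  {v | ∃ a : Fin I.m → ℝ, ∑ j, a j ≤ (k : ℝ) ∧ (∀ j, 0 ≤ a j ∧ a j ≤ ∑ i, I.p i j) ∧
    v = ∑ j, I.r j * a j}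

/-- The optimal value of the ex-ante relaxation. -/
def ExAnte : ℝ := sSup I.exAnteValues

/-- An online policy, given by the set `A ω` of agents that it accepts when the types are `ω`:
at most `k` agents are accepted, and whether agent `i` is accepted depends only on the types
of the agents that have arrived up to and including `i`. -/
structure Policy where
  A : (Fin n → Fin I.m) → Finset (Fin n)
  card_le : ∀ ω, (A ω).card ≤ k
  nonanticipating : ∀ (i : Fin n) (ω ω' : Fin n → Fin I.m),
    (∀ i' ≤ i, ω i' = ω' i') → (i ∈ A ω ↔ i ∈ A ω')

/-- The expected sum of the valuations of the agents accepted by a policy. -/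
def policyValue (π : I.Policy) : ℝ :=
  I.expect fun ω => ∑ i ∈ π.A ω, I.r (ω i)

/-- The performance of the optimal online policy, i.e. of the dynamic program. (There are
finitely many policies, so the supremum is a maximum.) -/
def DP : ℝ := ⨆ π : I.Policy, I.policyValue π

end Instance

/-- The type distributions of `n` agents in cumulative form: `G i j` is the probability that
the type of agent `i` is `j` or better. -/
structure TypeDist (n : ℕ) where
  m : ℕ
  m_pos : 0 < m
  G : Fin n → Fin m → ℝ
  G_nonneg : ∀ i j, 0 ≤ G i j
  G_mono : ∀ i, Monotone (G i)
  G_last : ∀ i, G i ⟨m - 1, Nat.sub_lt m_pos one_pos⟩ = 1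

/-- `E[min {∑ i, Ber (g i), k}]` for independent Bernoulli variables; `S` is the set of
successes. -/
def expMinBer {n : ℕ} (k : ℕ) (g : Fin n → ℝ) : ℝ :=
  ∑ S : Finset (Fin n), ((∏ i ∈ S, g i) * ∏ i ∈ Sᶜ, (1 - g i)) * min (S.card : ℝ) (k : ℝ)

/-- `Q_j` for the prophet. -/
def TypeDist.prophQ {n : ℕ} (k : ℕ) (G : TypeDist n) (j : Fin G.m) : ℝ :=
  expMinBer k fun i => G.G i j

/-- `Q_j` for the ex-ante relaxation. -/
def TypeDist.exAnteQ {n : ℕ} (k : ℕ) (G : TypeDist n) (j : Fin G.m) : ℝ :=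
  min (∑ i, G.G i j) (k : ℝ)

/-- The state-updating constraints on `x` and `y`. The index `l : Fin k` stands for `l + 1`
remaining slots, so `l + 1 = k` is the state in which all slots are still free; `y` is
understood to be `0` for `k + 1` remaining slots. -/
structure IsStateFlow {k n : ℕ} (x y : Fin n → Fin k → ℝ) : Prop where
  le : ∀ i l, y i l ≤ x i l
  nonneg : ∀ i l, 0 ≤ y i l
  init : ∀ (h : 0 < n) (l : Fin k), x ⟨0, h⟩ l = if (l : ℕ) + 1 = k then 1 else 0
  step : ∀ (i : ℕ) (h : i + 1 < n) (l : Fin k),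
    x ⟨i + 1, h⟩ l = x ⟨i, Nat.lt_of_succ_lt h⟩ l - y ⟨i, Nat.lt_of_succ_lt h⟩ l +
      (if h' : (l : ℕ) + 1 < k then y ⟨i, Nat.lt_of_succ_lt h⟩ ⟨l + 1, h'⟩ else 0)

/-- The set of all `θ` that are feasible, for some `x` and `y`, in the simplified Type Coverage
dual linear program with coefficients `Q`. -/
def feasibleTheta {n : ℕ} (k : ℕ) (G : TypeDist n) (Q : Fin G.m → ℝ) : Set ℝ :=
  {θ | ∃ x y : Fin n → Fin k → ℝ, IsStateFlow x y ∧
    ∀ j, θ * Q j ≤ ∑ i, ∑ l, min (y i l) (G.G i j * x i l)}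

/-- The optimal value of the simplified dual relative to the prophet. -/
def innerLPProph {n : ℕ} (k : ℕ) (G : TypeDist n) : ℝ :=
  sSup (feasibleTheta k G (G.prophQ k))

/-- The optimal value of the simplified dual relative to the ex-ante relaxation. -/
def innerLPExAnte {n : ℕ} (k : ℕ) (G : TypeDist n) : ℝ :=
  sSup (feasibleTheta k G (G.exAnteQ k))

end ProphetIneq

end

/-! Write the valuations as tails `r j = ∑ t ∈ Ici j, D t` with weights `D ≥ 0`, and let `G` be the
cumulative type distributions. Everything becomes linear in `D`: each benchmark is `∑ j, D j * Q j`
with `Q` depending only on `G` (`Proph_eq`, `ExAnte_eq`), and `DP` is the maximum of `∑ j, D j *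
coverage j` over state flows. For the latter, the state and acceptance probabilities of a policy
form a flow. Slots left are independent of the arriving type, so types up to `j` are accepted in a
given state with probability at most `min y (G * x)` (`policyValue_le_coverage`). Conversely, the
value of any flow telescopes against the Bellman recursion (`IsValueFunction.coverage_le`), whose
value some policy attains. For fixed `G`, a ratio of at least `θ` for all `D` thus means that every
`D` admits a flow with `∑ j, D j * (coverage j - θ * Q j) ≥ 0`. Coverage is concave on a compact
convex set of flows, so separation (`exists_weights_of_infeasible`) yields one flow good for all `j`
at once, which is feasibility of `θ`. Ranging over `G` gives both identities. -/

namespace ProphetIneq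

/-- The coverage of type `j` by a state flow. -/
def coverage {k n m : ℕ} (G : Fin n → Fin m → ℝ) (x y : Fin n → Fin k → ℝ) (j : Fin m) : ℝ :=
  ∑ i, ∑ l, min (y i l) (G i j * x i l)

/-! ### Increments, tails and Abel summation. -/

section Cumulative

variable {m : ℕ}

/-- The increments of a finite sequence. -/
def increments (c : Fin m → ℝ) (j : Fin m) : ℝ :=
  c j - if (j : ℕ) = 0 then 0 else c ⟨j - 1, (Nat.sub_le _ _).trans_lt j.2⟩

theorem sum_Iic_eq_sum_range (p : Fin m → ℝ) (j : Fin m) :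
    ∑ t ∈ Iic j, p t = ∑ t ∈ range (j + 1), if h : t < m then p ⟨t, h⟩ else 0 := by
  refine Finset.sum_bij (fun t _ => (t : ℕ)) ?_ ?_ ?_ ?_
  · intro t ht
    have : t ≤ j := Finset.mem_Iic.1 ht
    simp only [Finset.mem_range]
    have : (t : ℕ) ≤ j := this
    omega
  · intro a _ b _ h
    exact Fin.ext h
  · intro b hb
    have hb' : b < j + 1 := Finset.mem_range.1 hb
    refine ⟨⟨b, by omega⟩, ?_, rfl⟩
    rw [Finset.mem_Iic, Fin.le_def]
    simp only
    omega
  · intro t _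
    simp

theorem sum_increments (c : Fin m → ℝ) (j : Fin m) : ∑ t ∈ Iic j, increments c t = c j := by
  obtain ⟨j, hj⟩ := j
  rw [sum_Iic_eq_sum_range]
  simp only
  induction j with
  | zero => simp [increments, hj]
  | succ j ih =>
    rw [Finset.sum_range_succ, ih (by omega)]
    simp [increments, hj]

theorem increments_cumulative (p : Fin m → ℝ) :
    increments (fun j => ∑ t ∈ Iic j, p t) = p := by
  funext j
  obtain ⟨j, hj⟩ := j
  unfold increments
  cases j with
  | zero => simp [sum_Iic_eq_sum_range, hj]
  | succ j =>
    simp only [sum_Iic_eq_sum_range]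
    rw [Finset.sum_range_succ]
    simp [hj]

theorem increments_nonneg {c : Fin m → ℝ} (hc : Monotone c) (h0 : ∀ j, 0 ≤ c j) (j : Fin m) :
    0 ≤ increments c j := by
  unfold increments
  split_ifs with h
  · simpa using h0 j
  · have := hc (show (⟨j - 1, (Nat.sub_le _ _).trans_lt j.2⟩ : Fin m) ≤ j by
      rw [Fin.le_def]; simp)
    linarith

theorem increments_sub (c d : Fin m → ℝ) (j : Fin m) :
    increments (fun t => d t - c t) j = increments d j - increments c j := by
  unfold increments
  split_ifs <;> ring

theorem increments_const_mul (a : ℝ) (c : Fin m → ℝ) (j : Fin m) :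
    increments (fun t => c t * a) j = increments c j * a := by
  unfold increments
  split_ifs <;> ring

theorem sum_Iic_last (hm : 0 < m) (p : Fin m → ℝ) :
    ∑ t ∈ Iic (⟨m - 1, Nat.sub_lt hm one_pos⟩ : Fin m), p t = ∑ t, p t := by
  congr 1
  ext t
  simp only [Finset.mem_Iic, Finset.mem_univ, iff_true, Fin.le_def]
  omega

theorem cumulative_mono {p : Fin m → ℝ} (hp : ∀ j, 0 ≤ p j) :
    Monotone fun j => ∑ t ∈ Iic j, p t := fun _ _ h =>
  Finset.sum_le_sum_of_subset_of_nonneg (Finset.Iic_subset_Iic.2 h) fun t _ _ => hp t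

/-- Abel summation: both sides sum `D t * a j` over the pairs `j ≤ t`. -/
theorem sum_mul_tail (D a : Fin m → ℝ) :
    ∑ j, (∑ t ∈ Ici j, D t) * a j = ∑ j, D j * ∑ t ∈ Iic j, a t := by
  simp_rw [Finset.sum_mul, Finset.mul_sum]
  refine Finset.sum_comm' ?_
  intro x y
  simp

theorem tail_eq_sum_ite (D : Fin m → ℝ) (j : Fin m) :
    ∑ t ∈ Ici j, D t = ∑ t, D t * if j ≤ t then 1 else 0 := by
  simp only [mul_ite, mul_one, mul_zero]
  rw [← Finset.sum_filter]
  congr 1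
  ext
  simp

/-- An antitone nonnegative sequence is the sequence of tails of a nonnegative one. -/
theorem exists_tail {r : Fin m → ℝ} (hr : Antitone r) (h0 : ∀ j, 0 ≤ r j) :
    ∃ D : Fin m → ℝ, (∀ j, 0 ≤ D j) ∧ ∀ j, r j = ∑ t ∈ Ici j, D t := by
  -- Extension by zero makes the last weight equal to the last valuation, so the telescoping sum has
  -- no remainder.
  let R : ℕ → ℝ := fun t => if h : t < m then r ⟨t, h⟩ else 0
  have hR : ∀ j : Fin m, R j = r j := fun j => by simp [R]
  refine ⟨fun j => R j - R (j + 1), fun j => ?_, fun j => ?_⟩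
  · simp only [hR]
    by_cases h : (j : ℕ) + 1 < m
    · have := hr (show j ≤ ⟨j + 1, h⟩ by rw [Fin.le_def]; simp)
      simpa [R, h] using this
    · simpa [R, h] using h0 j
  · have h1 : ∑ t ∈ Ici j, (R t - R (t + 1)) = ∑ t ∈ Finset.Ico (j : ℕ) m, (R t - R (t + 1)) := by
      refine Finset.sum_bij (fun t _ => (t : ℕ)) ?_ ?_ ?_ ?_
      · intro t ht
        have : j ≤ t := Finset.mem_Ici.1 ht
        rw [Finset.mem_Ico]
        exact ⟨Fin.le_def.1 this, t.2⟩
      · intro a _ b _ h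
        exact Fin.ext h
      · intro b hb
        rw [Finset.mem_Ico] at hb
        exact ⟨⟨b, hb.2⟩, by rw [Finset.mem_Ici, Fin.le_def]; exact hb.1, rfl⟩
      · intro t _
        rfl
    rw [h1, Finset.sum_Ico_eq_sub _ j.2.le, Finset.sum_range_sub', Finset.sum_range_sub', hR]
    simp [R]

end Cumulative

/-! ### Expectations over independent types. -/

namespace Instance

variable {k n : ℕ} (I : Instance k n)

theorem expect_congr {f g : (Fin n → Fin I.m) → ℝ} (h : ∀ ω, f ω = g ω) :
    I.expect f = I.expect g := by
  rw [funext h]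

theorem expect_add (f g : (Fin n → Fin I.m) → ℝ) :
    I.expect (fun ω => f ω + g ω) = I.expect f + I.expect g := by
  simp [expect, mul_add, Finset.sum_add_distrib]

theorem expect_sub (f g : (Fin n → Fin I.m) → ℝ) :
    I.expect (fun ω => f ω - g ω) = I.expect f - I.expect g := by
  simp [expect, mul_sub, Finset.sum_sub_distrib]

theorem expect_sum {ι : Type*} (s : Finset ι) (f : ι → (Fin n → Fin I.m) → ℝ) :
    I.expect (fun ω => ∑ a ∈ s, f a ω) = ∑ a ∈ s, I.expect (f a) := by
  simp only [expect, Finset.mul_sum]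
  exact Finset.sum_comm

theorem expect_const_mul (c : ℝ) (f : (Fin n → Fin I.m) → ℝ) :
    I.expect (fun ω => c * f ω) = c * I.expect f := by
  simp only [expect, Finset.mul_sum]
  exact Finset.sum_congr rfl fun ω _ => by ring

theorem weight_nonneg (ω : Fin n → Fin I.m) : 0 ≤ ∏ i, I.p i (ω i) :=
  Finset.prod_nonneg fun i _ => I.p_nonneg i (ω i)

theorem expect_mono {f g : (Fin n → Fin I.m) → ℝ} (h : ∀ ω, f ω ≤ g ω) :
    I.expect f ≤ I.expect g :=
  Finset.sum_le_sum fun ω _ => mul_le_mul_of_nonneg_left (h ω) (I.weight_nonneg ω)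

theorem expect_const (c : ℝ) : I.expect (fun _ => c) = c := by
  have h := Finset.prod_univ_sum (fun _ : Fin n => (univ : Finset (Fin I.m))) fun i j => I.p i j
  simp only [I.p_sum, Finset.prod_const_one, Fintype.piFinset_univ] at h
  rw [expect, ← Finset.sum_mul, ← h, one_mul]

theorem expect_nonneg {f : (Fin n → Fin I.m) → ℝ} (h : ∀ ω, 0 ≤ f ω) : 0 ≤ I.expect f :=
  Finset.sum_nonneg fun ω _ => mul_nonneg (I.weight_nonneg ω) (h ω)

/-- Resampling the type of one agent does not change an expectation. -/
theorem expect_resample (i : Fin n) (f : (Fin n → Fin I.m) → ℝ) :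
    I.expect f = I.expect fun ω => ∑ j, I.p i j * f (Function.update ω i j) := by
  have hswap : ∀ (ω : Fin n → Fin I.m) (j : Fin I.m),
      (∏ a, I.p a (ω a)) * I.p i j =
        (∏ a, I.p a (Function.update ω i j a)) * I.p i (ω i) := by
    intro ω j
    rw [← Finset.mul_prod_erase univ _ (Finset.mem_univ i),
      ← Finset.mul_prod_erase univ (fun a => I.p a (Function.update ω i j a))
        (Finset.mem_univ i), Function.update_self]
    have : ∏ a ∈ univ.erase i, I.p a (Function.update ω i j a) =
        ∏ a ∈ univ.erase i, I.p a (ω a) :=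
      Finset.prod_congr rfl fun a ha => by
        rw [Function.update_of_ne (Finset.ne_of_mem_erase ha)]
    rw [this]
    ring
  have h1 : I.expect f = ∑ q : (Fin n → Fin I.m) × Fin I.m,
      (∏ a, I.p a (q.1 a)) * I.p i q.2 * f q.1 := by
    rw [Fintype.sum_prod_type]
    refine Finset.sum_congr rfl fun ω _ => ?_
    simp only
    rw [← Finset.sum_mul, ← Finset.mul_sum, I.p_sum, mul_one]
  have h2 : (I.expect fun ω => ∑ j, I.p i j * f (Function.update ω i j)) =
      ∑ q : (Fin n → Fin I.m) × Fin I.m,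
        (∏ a, I.p a (q.1 a)) * I.p i q.2 * f (Function.update q.1 i q.2) := by
    rw [Fintype.sum_prod_type]
    refine Finset.sum_congr rfl fun ω _ => ?_
    simp only [Finset.mul_sum, mul_assoc]
  rw [h1, h2]
  -- Exchanging the type of agent `i` with the fresh sample is an involution that preserves the
  -- joint weight.
  let e : (Fin n → Fin I.m) × Fin I.m → (Fin n → Fin I.m) × Fin I.m :=
    fun q => (Function.update q.1 i q.2, q.1 i)
  have he : Function.Involutive e := fun q => by simp [e]
  refine (Fintype.sum_bijective e he.bijective _ _ fun q => ?_).symm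
  rw [hswap]

/-- The probability that agent `i` has type `j` or better. -/
def cdf (i : Fin n) (j : Fin I.m) : ℝ := ∑ t ∈ Iic j, I.p i t

theorem cdf_nonneg (i : Fin n) (j : Fin I.m) : 0 ≤ I.cdf i j :=
  Finset.sum_nonneg fun t _ => I.p_nonneg i t

theorem cdf_mono (i : Fin n) : Monotone (I.cdf i) := cumulative_mono (I.p_nonneg i)

theorem m_pos (hn : 0 < n) : 0 < I.m := by
  rcases Nat.eq_zero_or_pos I.m with h | h
  · have h1 := I.p_sum ⟨0, hn⟩
    have : IsEmpty (Fin I.m) := by rw [h]; infer_instance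
    simp at h1
  · exact h

theorem cdf_last (hm : 0 < I.m) (i : Fin n) : I.cdf i ⟨I.m - 1, Nat.sub_lt hm one_pos⟩ = 1 := by
  rw [cdf, sum_Iic_last hm, I.p_sum]

/-- An event about agent `i`'s type is independent of the other agents' types. -/
theorem expect_mul_le_type (i : Fin n) (j : Fin I.m) {f : (Fin n → Fin I.m) → ℝ}
    (hf : ∀ ω t, f (Function.update ω i t) = f ω) :
    I.expect (fun ω => f ω * if ω i ≤ j then 1 else 0) = I.cdf i j * I.expect f := by
  rw [I.expect_resample i, ← I.expect_const_mul]
  refine I.expect_congr fun ω => ?_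
  simp only [hf, Function.update_self]
  rw [cdf, Finset.sum_mul]
  have : Iic j = univ.filter fun t => t ≤ j := by ext; simp
  rw [this, Finset.sum_filter]
  refine Finset.sum_congr rfl fun t _ => ?_
  split_ifs <;> ring

end Instance

end ProphetIneq

/-! ### From policies to state flows. -/

namespace ProphetIneq

namespace Instance

variable {k n : ℕ} (I : Instance k n)

/-- The number of agents before time `i` in a set of agents. -/
def numBefore (S : Finset (Fin n)) (i : ℕ) : ℕ := (S.filter fun a : Fin n => (a : ℕ) < i).card

theorem numBefore_zero (S : Finset (Fin n)) : numBefore S 0 = 0 := by simp [numBefore]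

theorem numBefore_succ (S : Finset (Fin n)) (i : Fin n) :
    numBefore S (i + 1) = numBefore S i + if i ∈ S then 1 else 0 := by
  unfold numBefore
  split_ifs with h
  · rw [← Finset.card_insert_of_notMem (a := i) (by simp)]
    congr 1
    ext a
    simp only [Finset.mem_filter, Finset.mem_insert, Fin.ext_iff]
    constructor
    · rintro ⟨h1, h2⟩
      rcases Nat.lt_succ_iff_lt_or_eq.1 h2 with h3 | h3
      · exact Or.inr ⟨h1, h3⟩
      · exact Or.inl h3
    · rintro (h1 | ⟨h1, h2⟩)
      · exact ⟨(Fin.ext h1 : a = i) ▸ h, by omega⟩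
      · exact ⟨h1, by omega⟩
  · congr 1
    ext a
    simp only [Finset.mem_filter]
    refine and_congr_right fun h1 => ?_
    have : (a : ℕ) ≠ i := fun h2 => h ((Fin.ext h2 : a = i) ▸ h1)
    omega

theorem numBefore_lt {S : Finset (Fin n)} (hS : S.card ≤ k) {i : Fin n} (hi : i ∈ S) :
    numBefore S i < k := by
  have h1 := numBefore_succ S i
  rw [if_pos hi] at h1
  have h2 : numBefore S (i + 1) ≤ S.card := Finset.card_le_card (Finset.filter_subset _ _)
  omega

/-- Earlier decisions cannot see the type of agent `i`; this is the independence behind the bound `G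
* x` on acceptances. -/
theorem numBefore_update (π : I.Policy) (ω : Fin n → Fin I.m) (i : Fin n) (t : Fin I.m) :
    numBefore (π.A (Function.update ω i t)) i = numBefore (π.A ω) i := by
  unfold numBefore
  congr 1
  ext a
  simp only [Finset.mem_filter]
  refine and_congr_left fun h => π.nonanticipating a _ _ fun b hb => ?_
  rw [Function.update_of_ne]
  rintro rfl
  rw [Fin.le_def] at hb
  omega

/-- The probability that the policy has `l + 1` slots left on the arrival of agent `i`. -/
def stateProb (π : I.Policy) (i : Fin n) (l : Fin k) : ℝ :=
  I.expect fun ω => if numBefore (π.A ω) i + l + 1 = k then 1 else 0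

/-- The probability that the policy accepts agent `i` with `l + 1` slots left. -/
def acceptProb (π : I.Policy) (i : Fin n) (l : Fin k) : ℝ :=
  I.expect fun ω => if numBefore (π.A ω) i + l + 1 = k ∧ i ∈ π.A ω then 1 else 0

theorem isStateFlow_policy (π : I.Policy) : IsStateFlow (I.stateProb π) (I.acceptProb π) where
  le i l := I.expect_mono fun ω => by
    by_cases h : numBefore (π.A ω) i + l + 1 = k <;> by_cases h' : i ∈ π.A ω <;> simp [h, h']
  nonneg i l := I.expect_nonneg fun ω => by split_ifs <;> norm_num
  init h l := by
    simp only [stateProb, numBefore_zero, zero_add]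
    exact I.expect_const _
  step i h l := by
    -- A state is reached by rejecting in the same state or by accepting with one more slot left.
    have key : I.stateProb π ⟨i + 1, h⟩ l = I.expect fun ω =>
        ((if numBefore (π.A ω) i + l + 1 = k then (1 : ℝ) else 0) -
          if numBefore (π.A ω) i + l + 1 = k ∧ (⟨i, Nat.lt_of_succ_lt h⟩ : Fin n) ∈ π.A ω
            then 1 else 0) +
        if numBefore (π.A ω) i + (l + 1) + 1 = k ∧ (⟨i, Nat.lt_of_succ_lt h⟩ : Fin n) ∈ π.A ω
          then 1 else 0 := by
      refine I.expect_congr fun ω => ?_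
      have := numBefore_succ (π.A ω) ⟨i, Nat.lt_of_succ_lt h⟩
      simp only at this ⊢
      rw [this]
      by_cases hi : (⟨i, Nat.lt_of_succ_lt h⟩ : Fin n) ∈ π.A ω
      · simp only [hi, if_true, and_true, sub_self, zero_add]
        congr 1
        rw [eq_iff_iff]
        omega
      · simp [hi]
    rw [key, I.expect_add, I.expect_sub]
    congr 1
    split_ifs with hl
    · rfl
    -- Here the state above would have more than `k` slots left.
    · have h0 : ∀ ω, ¬ (numBefore (π.A ω) i + (l + 1) + 1 = k ∧
          (⟨i, Nat.lt_of_succ_lt h⟩ : Fin n) ∈ π.A ω) := fun ω hω => by omega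
      simp only [h0, if_false]
      exact I.expect_const 0

/-- An accepted agent of type `t` collects `D j` for every `j ≥ t`. Accepting a type up to `j` in a
given state is contained both in accepting in that state and in being there when such a type
arrives. -/
theorem policyValue_le_coverage (π : I.Policy) {D : Fin I.m → ℝ} (hD : ∀ j, 0 ≤ D j)
    (hr : ∀ j, I.r j = ∑ t ∈ Ici j, D t) :
    I.policyValue π ≤ ∑ j, D j * coverage I.cdf (I.stateProb π) (I.acceptProb π) j := by
  have hpt : ∀ ω, ∑ i ∈ π.A ω, I.r (ω i) = ∑ j, D j * ∑ i : Fin n, ∑ l : Fin k,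
      (if numBefore (π.A ω) i + l + 1 = k ∧ i ∈ π.A ω then (1 : ℝ) else 0) *
        if ω i ≤ j then 1 else 0 := by
    intro ω
    -- An accepted agent is accepted in exactly one state, as fewer than `k` were accepted before.
    have hslot : ∀ i : Fin n, ∑ l : Fin k,
        (if numBefore (π.A ω) i + l + 1 = k ∧ i ∈ π.A ω then (1 : ℝ) else 0) =
          if i ∈ π.A ω then 1 else 0 := by
      intro i
      by_cases hi : i ∈ π.A ω
      · have hlt := numBefore_lt (π.card_le ω) hi
        rw [Finset.sum_eq_single ⟨k - 1 - numBefore (π.A ω) i, by omega⟩]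
        · rw [if_pos hi, if_pos ⟨by simp only; omega, hi⟩]
        · intro l _ hl
          rw [if_neg]
          rintro ⟨h, -⟩
          exact hl (Fin.ext (by simp only; omega))
        · simp
      · simp [hi]
    simp_rw [← Finset.sum_mul, hslot, hr, tail_eq_sum_ite, Finset.mul_sum]
    rw [Finset.sum_comm]
    refine Finset.sum_congr rfl fun j _ => ?_
    simp_rw [ite_mul, one_mul, zero_mul, mul_ite, mul_zero]
    simp
  rw [policyValue, I.expect_congr hpt, I.expect_sum]
  refine Finset.sum_le_sum fun j _ => ?_
  rw [I.expect_const_mul, I.expect_sum]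
  refine mul_le_mul_of_nonneg_left (Finset.sum_le_sum fun i _ => ?_) (hD j)
  rw [I.expect_sum]
  refine Finset.sum_le_sum fun l _ => le_min (I.expect_mono fun ω => ?_) ?_
  · split_ifs <;> norm_num
  · rw [stateProb, ← I.expect_mul_le_type i j]
    · refine I.expect_mono fun ω => ?_
      by_cases h : numBefore (π.A ω) i + l + 1 = k <;> by_cases h' : i ∈ π.A ω <;>
        by_cases h'' : ω i ≤ j <;> simp [h, h', h'']
    · intro ω t
      rw [numBefore_update]

end Instance

end ProphetIneq

/-! ### The dynamic program dominates every state flow. -/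

namespace ProphetIneq

namespace Instance

variable {k n : ℕ} (I : Instance k n)

/-- The optimal values of the dynamic program: `V i l` is the value of facing agents
`i, i + 1, …` with `l` slots left. -/
structure IsValueFunction (V : ℕ → ℕ → ℝ) : Prop where
  last : ∀ l, V n l = 0
  zero : ∀ i, V i 0 = 0
  succ : ∀ (i : Fin n) (l : ℕ),
    V i (l + 1) = ∑ j, I.p i j * max (V (i + 1) (l + 1)) (I.r j + V (i + 1) l)

theorem exists_isValueFunction : ∃ V, I.IsValueFunction V := by
  -- Backward induction: `W t l` is the value with `t` agents still to come.
  let W : ℕ → ℕ → ℝ := fun t => Nat.rec (fun _ => 0) (fun t w l =>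
    if h : n - (t + 1) < n then
      (if l = 0 then 0 else
        ∑ j, I.p ⟨n - (t + 1), h⟩ j * max (w l) (I.r j + w (l - 1)))
    else 0) t
  have hW : ∀ t l, W (t + 1) l = if h : n - (t + 1) < n then
      (if l = 0 then 0 else
        ∑ j, I.p ⟨n - (t + 1), h⟩ j * max (W t l) (I.r j + W t (l - 1))) else 0 :=
    fun _ _ => rfl
  refine ⟨fun i => W (n - i), ⟨fun l => ?_, fun i => ?_, fun i l => ?_⟩⟩
  · simp [W]
  · rcases n - i with _ | t
    · rfl
    · simp [hW]
  · obtain ⟨i, hi⟩ := i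
    simp only
    have h1 : n - i = (n - (i + 1)) + 1 := by omega
    have h2 : n - (n - (i + 1) + 1) = i := by omega
    rw [h1, hW]
    simp [h2, hi]

variable {I}

/-- One step of the linear program is dominated by one step of the dynamic program. -/
theorem IsValueFunction.coverage_step {V : ℕ → ℕ → ℝ} (hV : I.IsValueFunction V)
    (hm : 0 < I.m) {D : Fin I.m → ℝ} (hr : ∀ j, I.r j = ∑ t ∈ Ici j, D t) (i : Fin n) (l : ℕ)
    {x y : ℝ} (hy : 0 ≤ y) (hyx : y ≤ x) :
    ∑ j, D j * min y (I.cdf i j * x) + (x - y) * V (i + 1) (l + 1) + y * V (i + 1) l ≤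
      x * V i (l + 1) := by
  have hx : 0 ≤ x := hy.trans hyx
  set c : Fin I.m → ℝ := fun j => min y (I.cdf i j * x) with hc
  have hmono : Monotone fun j => I.cdf i j * x := fun a b h =>
    mul_le_mul_of_nonneg_right (I.cdf_mono i h) hx
  -- The increments of `c` act as probabilities of accepting each type: they lie between `0` and
  -- `I.p i j * x` and sum to `y`. They describe the rule that accepts the best types first.
  have hz0 : ∀ j, 0 ≤ increments c j := increments_nonneg
    (fun a b h => min_le_min le_rfl (hmono h))
    fun j => le_min hy (mul_nonneg (I.cdf_nonneg i j) hx)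
  have hz1 : ∀ j, increments c j ≤ I.p i j * x := by
    intro j
    have h := increments_nonneg (c := fun j => I.cdf i j * x - c j) (fun a b h => by
      have h1 := hmono h
      simp only [hc] at h1 ⊢
      rcases le_total y (I.cdf i a * x) with h2 | h2
      · rw [min_eq_left h2, min_eq_left (h2.trans h1)]
        linarith
      · rw [min_eq_right h2]
        have := min_le_right y (I.cdf i b * x)
        linarith) (fun j => sub_nonneg.2 (min_le_right _ _)) j
    rw [increments_sub, increments_const_mul] at h
    have h3 : increments (I.cdf i) j = I.p i j := congrFun (increments_cumulative (I.p i)) j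
    rw [h3] at h
    linarith
  have hsum : ∑ j, increments c j = y := by
    rw [← sum_Iic_last hm, sum_increments]
    simp only [hc]
    rw [I.cdf_last hm, one_mul, min_eq_left hyx]
  have hD : ∑ j, D j * c j = ∑ j, I.r j * increments c j := by
    simp_rw [hr]
    rw [sum_mul_tail]
    simp_rw [sum_increments]
  have hpx : ∑ j, I.p i j * x = x := by rw [← Finset.sum_mul, I.p_sum, one_mul]
  have e : ∑ j, D j * c j + (x - y) * V (i + 1) (l + 1) + y * V (i + 1) l =
      ∑ j, (increments c j * (I.r j + V (i + 1) l) +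
        (I.p i j * x - increments c j) * V (i + 1) (l + 1)) := by
    simp_rw [mul_add, Finset.sum_add_distrib, ← Finset.sum_mul, Finset.sum_sub_distrib]
    rw [hpx, hsum, hD]
    simp_rw [mul_comm (increments c _)]
    ring
  rw [e, hV.succ, Finset.mul_sum]
  refine Finset.sum_le_sum fun j _ => ?_
  have h1 := mul_le_mul_of_nonneg_left
    (le_max_right (V (i + 1) (l + 1)) (I.r j + V (i + 1) l)) (hz0 j)
  have h2 := mul_le_mul_of_nonneg_left
    (le_max_left (V (i + 1) (l + 1)) (I.r j + V (i + 1) l)) (sub_nonneg.2 (hz1 j))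
  nlinarith

/-- An index shift; the boundary terms vanish because `V 0 = 0` and `y` is zero beyond `k` slots. -/
theorem sum_shift_slots (y : Fin k → ℝ) (V : ℕ → ℝ) (hV : V 0 = 0) :
    ∑ l : Fin k, (if h : (l : ℕ) + 1 < k then y ⟨l + 1, h⟩ else 0) * V (l + 1) =
      ∑ l : Fin k, y l * V l := by
  let Y : ℕ → ℝ := fun l => if h : l < k then y ⟨l, h⟩ else 0
  have h1 : ∑ l : Fin k, (if h : (l : ℕ) + 1 < k then y ⟨l + 1, h⟩ else 0) * V (l + 1) =
      ∑ l ∈ range k, Y (l + 1) * V (l + 1) :=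
    (Finset.sum_range fun l => Y (l + 1) * V (l + 1)).symm
  have h2 : ∑ l : Fin k, y l * V l = ∑ l ∈ range k, Y l * V l := by
    rw [Finset.sum_range]
    simp [Y]
  have h3 := Finset.sum_range_succ (fun l => Y l * V l) k
  rw [Finset.sum_range_succ' (fun l => Y l * V l) k] at h3
  have h4 : Y k = 0 := by simp [Y]
  rw [h1, h2]
  simpa [hV, h4] using h3

/-- The value of a state flow is at most the value of the dynamic program. -/
theorem IsValueFunction.coverage_le {V : ℕ → ℕ → ℝ} (hV : I.IsValueFunction V) (hk : 0 < k)
    (hn : 0 < n) {D : Fin I.m → ℝ} (hr : ∀ j, I.r j = ∑ t ∈ Ici j, D t)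
    {x y : Fin n → Fin k → ℝ} (hxy : IsStateFlow x y) :
    ∑ j, D j * coverage I.cdf x y j ≤ V 0 k := by
  have hm := I.m_pos hn
  -- The continuation value averaged over the flow at time `i`: what is collected at one step is at
  -- most its drop.
  let X : ℕ → ℝ := fun i => if h : i < n then ∑ l, x ⟨i, h⟩ l * V i (l + 1) else 0
  have hstep : ∀ i : Fin n, ∑ j, D j * ∑ l, min (y i l) (I.cdf i j * x i l) ≤
      X i - X (i + 1) := by
    intro i
    have h1 := Finset.sum_le_sum fun (l : Fin k) (_ : l ∈ univ) =>
      hV.coverage_step hm hr i l (hxy.nonneg i l) (hxy.le i l)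
    simp_rw [Finset.sum_add_distrib] at h1
    rw [Finset.sum_comm] at h1
    simp_rw [← Finset.mul_sum] at h1
    have hXi : X i = ∑ l, x i l * V i (l + 1) := by simp [X]
    have hX : X (i + 1) = ∑ l, (x i l - y i l) * V (i + 1) (l + 1) +
        ∑ l, y i l * V (i + 1) l := by
      by_cases hi : (i : ℕ) + 1 < n
      · have : X (i + 1) = ∑ l, x ⟨i + 1, hi⟩ l * V (i + 1) (l + 1) := by simp [X, hi]
        rw [this]
        simp_rw [hxy.step i hi, add_mul, Finset.sum_add_distrib]
        rw [sum_shift_slots _ (V (i + 1)) (hV.zero _)]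
      · have hin : (i : ℕ) + 1 = n := by omega
        have : ∀ l, V (i + 1) l = 0 := fun l => by rw [hin]; exact hV.last l
        simp [X, hi, this]
    rw [hXi, hX]
    linarith
  have hX0 : X 0 = V 0 k := by
    simp only [X, hn, dif_pos, hxy.init hn]
    rw [Finset.sum_eq_single ⟨k - 1, by omega⟩]
    · have : k - 1 + 1 = k := by omega
      simp [this]
    · intro l _ hl
      rw [if_neg, zero_mul]
      intro h
      exact hl (Fin.ext (by simp only; omega))
    · simp
  have hXn : X n = 0 := by simp [X]
  calc ∑ j, D j * coverage I.cdf x y j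
      = ∑ i, ∑ j, D j * ∑ l, min (y i l) (I.cdf i j * x i l) := by
        rw [Finset.sum_comm]
        simp_rw [coverage, Finset.mul_sum]
    _ ≤ ∑ i : Fin n, (X i - X (i + 1)) := Finset.sum_le_sum fun i _ => hstep i
    _ = X 0 - X n := by
        rw [← Finset.sum_range (fun i => X i - X (i + 1)), Finset.sum_range_sub']
    _ = V 0 k := by rw [hX0, hXn, sub_zero]

variable (I)

/-- The number of slots left at time `i` when agent `a` of type `j` is accepted with `l` slots
left exactly if `acc a l j`. -/
def slotsLeft (acc : Fin n → ℕ → Fin I.m → Bool) (ω : Fin n → Fin I.m) : ℕ → ℕ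
  | 0 => k
  | i + 1 => if h : i < n then
      (if acc ⟨i, h⟩ (slotsLeft acc ω i) (ω ⟨i, h⟩) then slotsLeft acc ω i - 1
        else slotsLeft acc ω i)
      else slotsLeft acc ω i

variable {I} in
theorem slotsLeft_succ (acc : Fin n → ℕ → Fin I.m → Bool) (ω : Fin n → Fin I.m) (i : Fin n) :
    I.slotsLeft acc ω (i + 1) = if acc i (I.slotsLeft acc ω i) (ω i)
      then I.slotsLeft acc ω i - 1 else I.slotsLeft acc ω i := by
  rw [slotsLeft, dif_pos i.2]

variable {I} in
theorem slotsLeft_congr (acc : Fin n → ℕ → Fin I.m → Bool) {ω ω' : Fin n → Fin I.m} (i : ℕ)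
    (h : ∀ a : Fin n, (a : ℕ) < i → ω a = ω' a) :
    I.slotsLeft acc ω i = I.slotsLeft acc ω' i := by
  induction i with
  | zero => rfl
  | succ i ih =>
    have h1 := ih fun a ha => h a (by omega)
    by_cases hi : i < n
    · rw [slotsLeft, slotsLeft, dif_pos hi, dif_pos hi, h1, h ⟨i, hi⟩ (by simp)]
    · rw [slotsLeft, slotsLeft, dif_neg hi, dif_neg hi, h1]

/-- The policy that accepts agent `i` of type `j` with `l` slots left exactly if `acc i l j`. -/
def statePolicy (acc : Fin n → ℕ → Fin I.m → Bool) (h0 : ∀ i j, acc i 0 j = false) :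
    I.Policy where
  A ω := univ.filter fun i => acc i (I.slotsLeft acc ω i) (ω i)
  card_le ω := by
    -- Slots left and acceptances so far sum to `k`; `h0` ensures that the natural subtraction never
    -- truncates.
    have key : ∀ i ≤ n, I.slotsLeft acc ω i +
        numBefore (univ.filter fun i => acc i (I.slotsLeft acc ω i) (ω i)) i = k := by
      intro i
      induction i with
      | zero => simp [slotsLeft, numBefore_zero]
      | succ i ih =>
        intro hi
        have h1 := ih (by omega)
        have h2 := slotsLeft_succ acc ω ⟨i, hi⟩
        have h3 := numBefore_succ
          (univ.filter fun i => acc i (I.slotsLeft acc ω i) (ω i)) ⟨i, hi⟩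
        simp only [Finset.mem_filter, Finset.mem_univ, true_and] at h2 h3
        rw [h2, h3]
        split_ifs with h
        · have : I.slotsLeft acc ω i ≠ 0 := fun h4 => by
            rw [h4, h0] at h
            exact absurd h (by simp)
          omega
        · exact h1
    have h := key n le_rfl
    have h' : numBefore (univ.filter fun i => acc i (I.slotsLeft acc ω i) (ω i)) n =
        (univ.filter fun i => acc i (I.slotsLeft acc ω i) (ω i)).card := by
      unfold numBefore
      rw [Finset.filter_true_of_mem fun a _ => a.2]
    omega
  nonanticipating i ω ω' h := by
    have h1 : I.slotsLeft acc ω i = I.slotsLeft acc ω' i :=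
      slotsLeft_congr acc i fun a ha => h a (Fin.le_def.2 ha.le)
    simp [h1, h i le_rfl]

open Classical in
/-- Some online policy attains the value of the dynamic program. -/
theorem IsValueFunction.exists_policy {I : Instance k n} {V : ℕ → ℕ → ℝ}
    (hV : I.IsValueFunction V) : ∃ π : I.Policy, I.policyValue π = V 0 k := by
  let acc : Fin n → ℕ → Fin I.m → Bool := fun i l j =>
    decide (l ≠ 0 ∧ V (i + 1) l ≤ I.r j + V (i + 1) (l - 1))
  have h0 : ∀ i j, acc i 0 j = false := fun i j => by simp [acc]
  refine ⟨I.statePolicy acc h0, ?_⟩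
  -- The expected continuation value. Under the optimal rule the expected reward from agent `i`
  -- equals its drop, so the rewards telescope.
  let Y : ℕ → ℝ := fun i => I.expect fun ω => V i (I.slotsLeft acc ω i)
  have hstep : ∀ i : Fin n,
      I.expect (fun ω => if acc i (I.slotsLeft acc ω i) (ω i) then I.r (ω i) else 0) =
        Y i - Y (i + 1) := by
    intro i
    rw [eq_sub_iff_add_eq, ← I.expect_add, I.expect_resample i]
    refine I.expect_congr fun ω => ?_
    simp only [slotsLeft_succ, Function.update_self]
    have hs : ∀ t, I.slotsLeft acc (Function.update ω i t) i = I.slotsLeft acc ω i :=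
      fun t => slotsLeft_congr acc i fun a ha => by
        rw [Function.update_of_ne]
        rintro rfl
        omega
    simp_rw [hs]
    generalize I.slotsLeft acc ω i = l
    cases l with
    | zero => simp [h0, hV.zero]
    | succ l =>
      rw [hV.succ]
      refine Finset.sum_congr rfl fun j _ => ?_
      congr 1
      by_cases h : V (i + 1) (l + 1) ≤ I.r j + V (i + 1) l
      · simp [acc, h]
      · simp [acc, h, max_eq_left (not_le.1 h).le]
  have h1 : I.policyValue (I.statePolicy acc h0) = ∑ i : Fin n, (Y i - Y (i + 1)) := by
    rw [policyValue]
    simp_rw [statePolicy, Finset.sum_filter]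
    rw [I.expect_sum]
    exact Finset.sum_congr rfl fun i _ => hstep i
  rw [h1, ← Finset.sum_range (fun i => Y i - Y (i + 1)), Finset.sum_range_sub']
  simp only [Y, hV.last, slotsLeft, I.expect_const, sub_zero]

theorem bddAbove_policyValue : BddAbove (Set.range fun π : I.Policy => I.policyValue π) := by
  have : (Set.range fun π : I.Policy => I.policyValue π) ⊆ Set.range
      fun A : (Fin n → Fin I.m) → Finset (Fin n) =>
        I.expect fun ω => ∑ i ∈ A ω, I.r (ω i) := by
    rintro _ ⟨π, rfl⟩
    exact ⟨π.A, rfl⟩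
  exact (Set.finite_range _).bddAbove.mono this

theorem coverage_le_DP (hk : 0 < k) (hn : 0 < n) {D : Fin I.m → ℝ}
    (hr : ∀ j, I.r j = ∑ t ∈ Ici j, D t) {x y : Fin n → Fin k → ℝ} (hxy : IsStateFlow x y) :
    ∑ j, D j * coverage I.cdf x y j ≤ I.DP := by
  obtain ⟨V, hV⟩ := I.exists_isValueFunction
  obtain ⟨π, hπ⟩ := hV.exists_policy
  exact (hV.coverage_le hk hn hr hxy).trans
    (hπ ▸ le_ciSup I.bddAbove_policyValue π)

theorem DP_le {D : Fin I.m → ℝ} (hD : ∀ j, 0 ≤ D j) (hr : ∀ j, I.r j = ∑ t ∈ Ici j, D t) {u : ℝ}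
    (hu : ∀ x y : Fin n → Fin k → ℝ, IsStateFlow x y →
      ∑ j, D j * coverage I.cdf x y j ≤ u) : I.DP ≤ u := by
  have : Nonempty I.Policy := ⟨⟨fun _ => ∅, by simp, by simp⟩⟩
  exact ciSup_le fun π => (I.policyValue_le_coverage π hD hr).trans
    (hu _ _ (I.isStateFlow_policy π))

end Instance

end ProphetIneq

/-! ### The benchmarks as linear functionals of the weights. -/

namespace ProphetIneq

/-- Among `n ≥ k` agents there are `k` whose types are the best. -/
theorem exists_best_agents {k n m : ℕ} (hkn : k ≤ n) (ω : Fin n → Fin m) :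
    ∃ S : Finset (Fin n), S.card = k ∧ ∀ i ∈ S, ∀ i' ∉ S, ω i ≤ ω i' := by
  refine ⟨(univ.filter fun i : Fin n => (i : ℕ) < k).map (Tuple.sort ω).toEmbedding, ?_, ?_⟩
  · rw [Finset.card_map, Fin.card_filter_val_lt, min_eq_right hkn]
  · intro i hi i' hi'
    rw [Finset.mem_map_equiv] at hi hi'
    simp only [Finset.mem_filter, Finset.mem_univ, true_and] at hi hi'
    have h := Tuple.monotone_sort ω
      (show (Tuple.sort ω).symm i ≤ (Tuple.sort ω).symm i' by rw [Fin.le_def]; omega)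
    simpa using h

namespace Instance

variable {k n : ℕ} (I : Instance k n)

theorem sum_valuations {D : Fin I.m → ℝ} (hr : ∀ j, I.r j = ∑ t ∈ Ici j, D t)
    (ω : Fin n → Fin I.m) (S : Finset (Fin n)) :
    ∑ i ∈ S, I.r (ω i) = ∑ j, D j * ((S.filter fun i => ω i ≤ j).card : ℝ) := by
  simp_rw [hr, tail_eq_sum_ite]
  rw [Finset.sum_comm]
  refine Finset.sum_congr rfl fun j _ => ?_
  rw [← Finset.mul_sum, Finset.sum_boole]

/-- The `k` best agents maximize the number of chosen types up to `j` for all `j` simultaneously, so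
the maximum can be taken term by term. -/
theorem max_valuations (hkn : k ≤ n) {D : Fin I.m → ℝ} (hD : ∀ j, 0 ≤ D j)
    (hr : ∀ j, I.r j = ∑ t ∈ Ici j, D t) (ω : Fin n → Fin I.m) :
    ((univ : Finset (Finset (Fin n))).filter fun S => S.card ≤ k).sup' ⟨∅, by simp⟩
      (fun S => ∑ i ∈ S, I.r (ω i)) =
    ∑ j, D j * min ((univ.filter fun i => ω i ≤ j).card : ℝ) k := by
  apply le_antisymm
  · refine Finset.sup'_le _ _ fun S hS => ?_
    rw [Finset.mem_filter] at hS
    rw [I.sum_valuations hr]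
    refine Finset.sum_le_sum fun j _ => mul_le_mul_of_nonneg_left (le_min ?_ ?_) (hD j)
    · exact_mod_cast Finset.card_le_card (Finset.filter_subset_filter _ (Finset.subset_univ S))
    · exact_mod_cast (Finset.card_le_card (Finset.filter_subset _ S)).trans hS.2
  · obtain ⟨S, hS, hbest⟩ := exists_best_agents hkn ω
    refine le_trans ?_ (Finset.le_sup' (fun S : Finset (Fin n) => ∑ i ∈ S, I.r (ω i))
      (show S ∈ _ by rw [Finset.mem_filter]; exact ⟨Finset.mem_univ _, hS.le⟩))
    rw [I.sum_valuations hr]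
    refine Finset.sum_le_sum fun j _ => mul_le_mul_of_nonneg_left ?_ (hD j)
    -- If some chosen agent is worse than `j`, every agent of type up to `j` is chosen.
    by_cases h : ∀ i ∈ S, ω i ≤ j
    · rw [Finset.filter_true_of_mem h, hS]
      exact min_le_right _ _
    · push Not at h
      obtain ⟨i, hi, hij⟩ := h
      refine (min_le_left _ _).trans ?_
      norm_cast
      refine Finset.card_le_card fun i' hi' => ?_
      rw [Finset.mem_filter] at hi' ⊢
      refine ⟨?_, hi'.2⟩
      by_contra h'
      exact absurd ((hbest i hi i' h').trans hi'.2) (not_le.2 hij)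

/-- The agents of type `j` or better form a random set with independent membership. -/
theorem expect_type_le (j : Fin I.m) (f : Finset (Fin n) → ℝ) :
    I.expect (fun ω => f (univ.filter fun i => ω i ≤ j)) =
      ∑ S : Finset (Fin n), ((∏ i ∈ S, I.cdf i j) * ∏ i ∈ Sᶜ, (1 - I.cdf i j)) * f S := by
  rw [expect, ← Finset.sum_fiberwise univ fun ω : Fin n → Fin I.m => univ.filter fun i => ω i ≤ j]
  refine Finset.sum_congr rfl fun S _ => ?_
  -- The event is a box, so its probability factors over the agents.
  have h1 : (univ.filter fun ω : Fin n → Fin I.m => (univ.filter fun i => ω i ≤ j) = S) =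
      Fintype.piFinset fun i => if i ∈ S then Iic j else (Iic j)ᶜ := by
    ext ω
    simp only [Finset.mem_filter, Finset.mem_univ, true_and, Fintype.mem_piFinset,
      Finset.ext_iff]
    refine forall_congr' fun i => ?_
    by_cases h : i ∈ S <;> simp [h]
  have h2 : ∀ i, ∑ t ∈ (if i ∈ S then Iic j else (Iic j)ᶜ), I.p i t =
      if i ∈ S then I.cdf i j else 1 - I.cdf i j := by
    intro i
    split_ifs
    · rfl
    · rw [cdf, ← I.p_sum i, eq_sub_iff_add_eq, add_comm, Finset.sum_add_sum_compl]
  have h3 : ∏ i, (if i ∈ S then I.cdf i j else 1 - I.cdf i j) =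
      (∏ i ∈ S, I.cdf i j) * ∏ i ∈ Sᶜ, (1 - I.cdf i j) := by
    rw [Finset.prod_ite]
    congr 2
    · ext; simp
    · ext; simp
  rw [← h3, ← Finset.prod_congr rfl fun i _ => h2 i, Finset.prod_univ_sum, ← h1, Finset.sum_mul]
  refine Finset.sum_congr rfl fun ω hω => ?_
  rw [Finset.mem_filter] at hω
  rw [hω.2]

theorem Proph_eq (hkn : k ≤ n) {D : Fin I.m → ℝ} (hD : ∀ j, 0 ≤ D j)
    (hr : ∀ j, I.r j = ∑ t ∈ Ici j, D t) :
    I.Proph = ∑ j, D j * expMinBer k fun i => I.cdf i j := by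
  rw [Proph, I.expect_congr (I.max_valuations hkn hD hr), I.expect_sum]
  refine Finset.sum_congr rfl fun j _ => ?_
  rw [I.expect_const_mul, I.expect_type_le j fun S => min (S.card : ℝ) k]
  rfl

/-- By Abel summation only the partial sums of `a` matter. Filling the best types first, up to total
mass `k`, maximizes all of them at once. -/
theorem ExAnte_eq (hn : 0 < n) {D : Fin I.m → ℝ} (hD : ∀ j, 0 ≤ D j)
    (hr : ∀ j, I.r j = ∑ t ∈ Ici j, D t) :
    I.ExAnte = ∑ j, D j * min (∑ i, I.cdf i j) (k : ℝ) := by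
  have hcum : ∀ j, ∑ i, I.cdf i j = ∑ t ∈ Iic j, ∑ i, I.p i t := fun j => Finset.sum_comm
  refine IsGreatest.csSup_eq ⟨?_, ?_⟩
  · set c : Fin I.m → ℝ := fun j => ∑ i, I.cdf i j with hc
    have hmono : Monotone c := fun a b h => Finset.sum_le_sum fun i _ => I.cdf_mono i h
    have h0 : ∀ j, 0 ≤ c j := fun j => Finset.sum_nonneg fun i _ => I.cdf_nonneg i j
    refine ⟨increments fun j => min (c j) k, ?_, fun j => ⟨?_, ?_⟩, ?_⟩
    · rw [← sum_Iic_last (I.m_pos hn), sum_increments]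
      exact min_le_right _ _
    · exact increments_nonneg (fun a b h => min_le_min (hmono h) le_rfl)
        (fun j => le_min (h0 j) k.cast_nonneg) j
    · have h := increments_nonneg (c := fun j => c j - min (c j) k) (fun a b h => by
        have h1 := hmono h
        simp only
        rcases le_total (c a) k with h2 | h2
        · rw [min_eq_left h2]
          have := min_le_left (c b) k
          linarith
        · rw [min_eq_right h2, min_eq_right (h2.trans h1)]
          linarith) (fun j => sub_nonneg.2 (min_le_left _ _)) j
      rw [increments_sub] at h
      have h3 : increments c j = ∑ i, I.p i j := by
        rw [hc]
        simp_rw [hcum]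
        exact congrFun (increments_cumulative fun t => ∑ i, I.p i t) j
      linarith
    · simp_rw [hr]
      rw [sum_mul_tail]
      simp_rw [sum_increments, hc]
  · rintro _ ⟨a, hak, ha, rfl⟩
    simp_rw [hr]
    rw [sum_mul_tail]
    refine Finset.sum_le_sum fun j _ => mul_le_mul_of_nonneg_left (le_min ?_ ?_) (hD j)
    · rw [hcum]
      exact Finset.sum_le_sum fun t _ => (ha t).2
    · exact (Finset.sum_le_sum_of_subset_of_nonneg (Finset.subset_univ _)
        fun t _ _ => (ha t).1).trans hak

end Instance

theorem expMinBer_one {n k : ℕ} (hkn : k ≤ n) {g : Fin n → ℝ} (hg : ∀ i, g i = 1) :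
    expMinBer k g = k := by
  rw [expMinBer, Finset.sum_eq_single univ]
  · simp [hg, hkn]
  · intro S _ hS
    have : Sᶜ.Nonempty := by
      rw [Finset.nonempty_iff_ne_empty, Ne, Finset.compl_eq_empty_iff]
      exact hS
    obtain ⟨i, hi⟩ := this
    rw [Finset.prod_eq_zero hi (by simp [hg]), mul_zero, zero_mul]
  · simp

end ProphetIneq

/-! ### The polytope of state flows and duality. -/

namespace ProphetIneq

section Flows

variable {k n : ℕ}

/-- The polytope of state flows. -/
def stateFlows (k n : ℕ) : Set ((Fin n → Fin k → ℝ) × (Fin n → Fin k → ℝ)) :=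
  {q | IsStateFlow q.1 q.2}

/-- A crude bound, needed only for compactness: each step adds at most one neighbouring state. -/
theorem IsStateFlow.le_two_pow {x y : Fin n → Fin k → ℝ} (h : IsStateFlow x y) (i : Fin n) :
    ∀ l, x i l ≤ 2 ^ (i : ℕ) := by
  obtain ⟨i, hi⟩ := i
  induction i with
  | zero =>
    intro l
    rw [h.init hi l]
    split_ifs <;> simp
  | succ i ih =>
    intro l
    have hi' := Nat.lt_of_succ_lt hi
    rw [h.step i hi l]
    have h1 := ih hi' l
    have h2 := h.nonneg ⟨i, hi'⟩ l
    have h3 : (if h' : (l : ℕ) + 1 < k then y ⟨i, hi'⟩ ⟨l + 1, h'⟩ else 0) ≤ 2 ^ i := by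
      split_ifs with h'
      · exact (h.le _ _).trans (ih hi' _)
      · positivity
    simp only at h1 ⊢
    rw [pow_succ]
    linarith

theorem IsStateFlow.mem_Icc {x y : Fin n → Fin k → ℝ} (h : IsStateFlow x y) (i : Fin n)
    (l : Fin k) : 0 ≤ x i l ∧ x i l ≤ 2 ^ n ∧ 0 ≤ y i l ∧ y i l ≤ 2 ^ n := by
  have h1 := h.nonneg i l
  have h2 := h.le i l
  have h3 := h.le_two_pow i l
  have h4 : (2 : ℝ) ^ (i : ℕ) ≤ 2 ^ n := pow_le_pow_right₀ one_le_two i.2.le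
  exact ⟨h1.trans h2, h3.trans h4, h1, h2.trans (h3.trans h4)⟩

theorem isClosed_stateFlows : IsClosed (stateFlows k n) := by
  have : stateFlows k n =
      {q | ∀ i l, q.2 i l ≤ q.1 i l} ∩ {q | ∀ i l, 0 ≤ q.2 i l} ∩
      {q | ∀ (h : 0 < n) (l : Fin k), q.1 ⟨0, h⟩ l = if (l : ℕ) + 1 = k then 1 else 0} ∩
      {q | ∀ (i : ℕ) (h : i + 1 < n) (l : Fin k),
        q.1 ⟨i + 1, h⟩ l =
          q.1 ⟨i, Nat.lt_of_succ_lt h⟩ l - q.2 ⟨i, Nat.lt_of_succ_lt h⟩ l +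
          (if h' : (l : ℕ) + 1 < k then q.2 ⟨i, Nat.lt_of_succ_lt h⟩ ⟨l + 1, h'⟩ else 0)} := by
    ext q
    constructor
    · intro h
      have h : IsStateFlow q.1 q.2 := h
      exact ⟨⟨⟨h.le, h.nonneg⟩, h.init⟩, h.step⟩
    · rintro ⟨⟨⟨h1, h2⟩, h3⟩, h4⟩
      exact ⟨h1, h2, h3, h4⟩
  rw [this]
  simp only [Set.ofPred_forall]
  refine ((IsClosed.inter ?_ ?_).inter ?_).inter ?_
  · exact isClosed_iInter fun i => isClosed_iInter fun l =>
      isClosed_le (by fun_prop) (by fun_prop)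
  · exact isClosed_iInter fun i => isClosed_iInter fun l =>
      isClosed_le (by fun_prop) (by fun_prop)
  · exact isClosed_iInter fun h => isClosed_iInter fun l =>
      isClosed_eq (by fun_prop) (by fun_prop)
  · refine isClosed_iInter fun i => isClosed_iInter fun h => isClosed_iInter fun l =>
      isClosed_eq (by fun_prop) ?_
    split_ifs <;> fun_prop

theorem isCompact_stateFlows : IsCompact (stateFlows k n) := by
  refine IsCompact.of_isClosed_subset
    (isCompact_Icc (a := (0 : (Fin n → Fin k → ℝ) × (Fin n → Fin k → ℝ)))
      (b := (fun _ _ => 2 ^ n, fun _ _ => 2 ^ n))) isClosed_stateFlows fun q hq => ?_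
  have h := IsStateFlow.mem_Icc hq
  exact ⟨⟨fun i l => (h i l).1, fun i l => (h i l).2.2.1⟩,
    ⟨fun i l => (h i l).2.1, fun i l => (h i l).2.2.2⟩⟩

theorem nonempty_stateFlows : (stateFlows k n).Nonempty := by
  refine ⟨(fun _ l => if (l : ℕ) + 1 = k then 1 else 0, fun _ _ => 0), ?_, ?_, ?_, ?_⟩
  · intro i l
    simp only
    split_ifs <;> norm_num
  · intro i l
    exact le_rfl
  · intro h l
    rfl
  · intro i h l
    simp

theorem convex_stateFlows : Convex ℝ (stateFlows k n) := by
  rintro q (hq : IsStateFlow q.1 q.2) q' (hq' : IsStateFlow q'.1 q'.2) a b ha hb hab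
  refine ⟨fun i l => ?_, fun i l => ?_, fun h l => ?_, fun i h l => ?_⟩
  · have h1 := mul_le_mul_of_nonneg_left (hq.le i l) ha
    have h2 := mul_le_mul_of_nonneg_left (hq'.le i l) hb
    simpa using add_le_add h1 h2
  · have h1 := mul_nonneg ha (hq.nonneg i l)
    have h2 := mul_nonneg hb (hq'.nonneg i l)
    simpa using add_nonneg h1 h2
  · simp only [Prod.fst_add, Prod.smul_fst, Pi.add_apply, Pi.smul_apply, smul_eq_mul,
      hq.init h, hq'.init h]
    rw [← add_mul, hab, one_mul]
  · simp only [Prod.fst_add, Prod.smul_fst, Prod.snd_add, Prod.smul_snd, Pi.add_apply,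
      Pi.smul_apply, smul_eq_mul, hq.step i h, hq'.step i h]
    split_ifs <;> ring

theorem coverage_nonneg {m : ℕ} {G : Fin n → Fin m → ℝ} (hG : ∀ i j, 0 ≤ G i j)
    {x y : Fin n → Fin k → ℝ} (h : IsStateFlow x y) (j : Fin m) : 0 ≤ coverage G x y j :=
  Finset.sum_nonneg fun i _ => Finset.sum_nonneg fun l _ =>
    le_min (h.nonneg i l) (mul_nonneg (hG i j) (h.mem_Icc i l).1)

/-- The vectors that are dominated by the coverage vector of some state flow. -/
def dominated (k : ℕ) {m : ℕ} (G : Fin n → Fin m → ℝ) : Set (Fin m → ℝ) :=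
  {v | ∃ x y : Fin n → Fin k → ℝ, IsStateFlow x y ∧ ∀ j, v j ≤ coverage G x y j}

-- The sum of a compact set, the image of the flows, and the closed nonpositive orthant.
open scoped Pointwise in
theorem isClosed_dominated {m : ℕ} (G : Fin n → Fin m → ℝ) : IsClosed (dominated k G) := by
  have hcont : Continuous fun q : (Fin n → Fin k → ℝ) × (Fin n → Fin k → ℝ) =>
      coverage G q.1 q.2 := by
    unfold coverage
    fun_prop
  have : dominated k G =
      (fun q : (Fin n → Fin k → ℝ) × (Fin n → Fin k → ℝ) => coverage G q.1 q.2) ''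
        stateFlows k n + Set.Iic 0 := by
    ext v
    rw [Set.mem_add]
    constructor
    · rintro ⟨x, y, h, hv⟩
      exact ⟨_, ⟨(x, y), h, rfl⟩, v - coverage G x y,
        fun j => sub_nonpos.2 (hv j), by simp⟩
    · rintro ⟨_, ⟨q, hq, rfl⟩, w, hw, rfl⟩
      refine ⟨q.1, q.2, hq, fun j => ?_⟩
      have : w j ≤ 0 := hw j
      simpa using this
  rw [this]
  exact isClosed_Iic.add_left_of_isCompact (isCompact_stateFlows.image hcont)

/-- Coverage is concave, being a sum of minima of linear functions; passing to dominated vectors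
turns this into convexity. -/
theorem convex_dominated {m : ℕ} (G : Fin n → Fin m → ℝ) : Convex ℝ (dominated k G) := by
  rintro v ⟨x, y, h, hv⟩ v' ⟨x', y', h', hv'⟩ a b ha hb hab
  refine ⟨_, _, convex_stateFlows (x := (x, y)) h (y := (x', y')) h' ha hb hab, fun j => ?_⟩
  have h1 := add_le_add (mul_le_mul_of_nonneg_left (hv j) ha)
    (mul_le_mul_of_nonneg_left (hv' j) hb)
  refine le_trans (by simpa using h1) ?_
  unfold coverage
  simp only [Finset.mul_sum, ← Finset.sum_add_distrib]
  refine Finset.sum_le_sum fun i _ => Finset.sum_le_sum fun l _ => ?_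
  simp only [Prod.fst_add, Prod.smul_fst, Prod.snd_add, Prod.smul_snd, Pi.add_apply,
      Pi.smul_apply, smul_eq_mul]
  refine le_min ?_ ?_
  · exact add_le_add (mul_le_mul_of_nonneg_left (min_le_left _ _) ha)
      (mul_le_mul_of_nonneg_left (min_le_left _ _) hb)
  · have h2 := mul_le_mul_of_nonneg_left (min_le_right (y i l) (G i j * x i l)) ha
    have h3 := mul_le_mul_of_nonneg_left (min_le_right (y' i l) (G i j * x' i l)) hb
    linarith

theorem mem_feasibleTheta {G : TypeDist n} {Q : Fin G.m → ℝ} {θ : ℝ} :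
    θ ∈ feasibleTheta k G Q ↔ (fun j => θ * Q j) ∈ dominated k G.G := Iff.rfl

theorem zero_mem_feasibleTheta (G : TypeDist n) (Q : Fin G.m → ℝ) :
    (0 : ℝ) ∈ feasibleTheta k G Q := by
  obtain ⟨q, hq⟩ := nonempty_stateFlows (k := k) (n := n)
  refine ⟨q.1, q.2, hq, fun j => ?_⟩
  rw [zero_mul]
  exact coverage_nonneg G.G_nonneg hq j

/-- One positive coefficient suffices to bound `θ`; the last type, where `G` is `1`, will provide
it. -/
theorem isGreatest_feasibleTheta (G : TypeDist n) {Q : Fin G.m → ℝ} (j : Fin G.m)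
    (hQ : 0 < Q j) : IsGreatest (feasibleTheta k G Q) (sSup (feasibleTheta k G Q)) := by
  have hclosed : IsClosed (feasibleTheta k G Q) :=
    (isClosed_dominated (k := k) G.G).preimage
      (show Continuous fun θ : ℝ => fun j => θ * Q j by fun_prop)
  have hbdd : BddAbove (feasibleTheta k G Q) := by
    refine ⟨(∑ _i : Fin n, ∑ _l : Fin k, (2 : ℝ) ^ n) / Q j, ?_⟩
    rintro θ ⟨x, y, h, hθ⟩
    rw [le_div_iff₀ hQ]
    exact (hθ j).trans (Finset.sum_le_sum fun i _ => Finset.sum_le_sum fun l _ =>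
      (min_le_left _ _).trans (h.mem_Icc i l).2.2.2)
  exact ⟨hclosed.csSup_mem ⟨0, zero_mem_feasibleTheta G Q⟩ hbdd,
    fun θ hθ => le_csSup hbdd hθ⟩

/-- Linear programming duality: an infeasible `θ` is certified by weights on the types. -/
theorem exists_weights_of_infeasible {G : TypeDist n} {Q : Fin G.m → ℝ} {θ : ℝ}
    (hθ : θ ∉ feasibleTheta k G Q) : ∃ (D : Fin G.m → ℝ) (u : ℝ), (∀ j, 0 ≤ D j) ∧ 0 ≤ u ∧
      (∀ x y : Fin n → Fin k → ℝ, IsStateFlow x y → ∑ j, D j * coverage G.G x y j ≤ u) ∧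
      u < θ * ∑ j, D j * Q j := by
  rw [mem_feasibleTheta] at hθ
  obtain ⟨f, u, hu, hfu⟩ := geometric_hahn_banach_closed_point
    (convex_dominated (k := k) G.G) (isClosed_dominated G.G) hθ
  have hf : ∀ v : Fin G.m → ℝ, f v = ∑ j, f (Pi.single j 1) * v j := by
    intro v
    conv_lhs => rw [pi_eq_sum_univ' v]
    rw [map_sum]
    refine Finset.sum_congr rfl fun j _ => ?_
    rw [map_smul, smul_eq_mul, mul_comm]
  obtain ⟨q, hq⟩ := nonempty_stateFlows (k := k) (n := n)
  have hneg : ∀ v : Fin G.m → ℝ, (∀ j, v j ≤ 0) → f v < u := fun v hv =>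
    hu v ⟨q.1, q.2, hq, fun j => (hv j).trans (coverage_nonneg G.G_nonneg hq j)⟩
  have hu0 : 0 < u := by simpa using hneg 0 fun _ => le_rfl
  refine ⟨fun j => f (Pi.single j 1), u, fun j => ?_, hu0.le, fun x y h => ?_, ?_⟩
  -- Were the weight of `j` negative, a nonpositive multiple of the `j`-th unit vector would reach
  -- the value `u`, contradicting strict separation.
  · by_contra h
    simp only [not_le] at h
    have h1 := hneg ((u / f (Pi.single j 1)) • Pi.single j 1) fun t => by
      have h2 : u / f (Pi.single j 1) ≤ 0 := (div_neg_of_pos_of_neg hu0 h).le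
      by_cases ht : t = j
      · subst ht; simpa using h2
      · simp [ht]
    rw [map_smul, smul_eq_mul, div_mul_cancel₀ _ h.ne] at h1
    exact lt_irrefl _ h1
  · rw [← hf (coverage G.G x y)]
    exact (hu _ ⟨x, y, h, fun _ => le_rfl⟩).le
  · rw [hf] at hfu
    refine hfu.trans_le (le_of_eq ?_)
    rw [Finset.mul_sum]
    exact Finset.sum_congr rfl fun j _ => by ring

end Flows

/-! ### Instances versus type distributions, and the theorem. -/

section Conversion

variable {k n : ℕ}

/-- The type distributions of an instance in cumulative form. -/
def Instance.toTypeDist (I : Instance k n) (hn : 0 < n) : TypeDist n where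
  m := I.m
  m_pos := I.m_pos hn
  G := I.cdf
  G_nonneg := I.cdf_nonneg
  G_mono := I.cdf_mono
  G_last := I.cdf_last (I.m_pos hn)

/-- The instance with given cumulative type distributions whose valuations have the increments
`D`. -/
def TypeDist.toInstance (k : ℕ) (G : TypeDist n) (D : Fin G.m → ℝ) (hD : ∀ j, 0 ≤ D j) :
    Instance k n where
  m := G.m
  r j := ∑ t ∈ Ici j, D t
  r_antitone _ _ h :=
    Finset.sum_le_sum_of_subset_of_nonneg (Finset.Ici_subset_Ici.2 h) fun t _ _ => hD t
  r_nonneg _ := Finset.sum_nonneg fun t _ => hD t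
  p i := increments (G.G i)
  p_nonneg i := increments_nonneg (G.G_mono i) (G.G_nonneg i)
  p_sum i := by rw [← sum_Iic_last G.m_pos, sum_increments, G.G_last]

theorem TypeDist.cdf_toInstance (G : TypeDist n) (D : Fin G.m → ℝ) (hD : ∀ j, 0 ≤ D j) :
    (G.toInstance k D hD).cdf = G.G := by
  funext i j
  exact sum_increments (G.G i) j

/-- If the benchmark `B` is the linear functional with coefficients `q (G · j)` of the increments
of the valuations, then the worst-case ratio of the dynamic program to `B` is the infimum of the
optimal values of the simplified duals with these coefficients. -/
theorem exists_isGLB_ratio_and_dual (hk : 0 < k) (hn : 0 < n) (q : (Fin n → ℝ) → ℝ)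
    (hq : ∀ g : Fin n → ℝ, (∀ i, g i = 1) → 0 < q g) (B : Instance k n → ℝ)
    (hB : ∀ (I : Instance k n) (D : Fin I.m → ℝ), (∀ j, 0 ≤ D j) →
      (∀ j, I.r j = ∑ t ∈ Ici j, D t) → B I = ∑ j, D j * q fun i => I.cdf i j) :
    (∀ G : TypeDist n, IsGreatest (feasibleTheta k G fun j => q fun i => G.G i j)
      (sSup (feasibleTheta k G fun j => q fun i => G.G i j))) ∧
    ∃ α : ℝ, IsGLB {ρ : ℝ | ∃ I : Instance k n, 0 < B I ∧ ρ = I.DP / B I} α ∧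
      IsGLB (Set.range fun G : TypeDist n =>
        sSup (feasibleTheta k G fun j => q fun i => G.G i j)) α := by
  have hmax : ∀ G : TypeDist n, IsGreatest (feasibleTheta k G fun j => q fun i => G.G i j)
      (sSup (feasibleTheta k G fun j => q fun i => G.G i j)) := fun G =>
    isGreatest_feasibleTheta G ⟨G.m - 1, Nat.sub_lt G.m_pos one_pos⟩ (hq _ fun i => G.G_last i)
  refine ⟨hmax, sInf (Set.range fun G : TypeDist n =>
        sSup (feasibleTheta k G fun j => q fun i => G.G i j)), ?_⟩
  have hglb := isGLB_csInf (s := Set.range fun G : TypeDist n =>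
      sSup (feasibleTheta k G fun j => q fun i => G.G i j))
    ⟨_, ⟨⟨1, one_pos, fun _ _ => 1, fun _ _ => zero_le_one, fun _ _ _ _ => le_rfl,
      fun _ => rfl⟩, rfl⟩⟩
    ⟨0, by rintro _ ⟨G, rfl⟩; exact (hmax G).2 (zero_mem_feasibleTheta G _)⟩
  refine ⟨?_, hglb⟩
  have hlb : lowerBounds {ρ : ℝ | ∃ I : Instance k n, 0 < B I ∧ ρ = I.DP / B I} =
      lowerBounds (Set.range fun G : TypeDist n =>
        sSup (feasibleTheta k G fun j => q fun i => G.G i j)) := by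
    ext b
    constructor
    · rintro hb _ ⟨G, rfl⟩
      refine le_of_forall_gt fun θ hθ => ?_
      have hθ0 : 0 < θ := ((hmax G).2 (zero_mem_feasibleTheta G _)).trans_lt hθ
      -- The separating weights, read as increments of valuations, give an instance whose ratio is
      -- below `θ`.
      obtain ⟨D, u, hD, hu0, hu, hlt⟩ :=
        exists_weights_of_infeasible fun h => absurd ((hmax G).2 h) (not_le.2 hθ)
      have hr : ∀ j, (G.toInstance k D hD).r j = ∑ t ∈ Ici j, D t := fun j => rfl
      have hDP : (G.toInstance k D hD).DP ≤ u := Instance.DP_le _ hD hr fun x y h => by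
        have := hu x y h
        rw [← G.cdf_toInstance (k := k) D hD] at this
        exact this
      have hBI : B (G.toInstance k D hD) = ∑ j, D j * q fun i => G.G i j := by
        rw [hB _ D hD hr, G.cdf_toInstance]
        rfl
      have hpos : 0 < B (G.toInstance k D hD) := by
        rw [hBI]
        exact pos_of_mul_pos_right (hu0.trans_lt hlt) hθ0.le
      refine (hb ⟨_, hpos, rfl⟩).trans_lt ?_
      rw [div_lt_iff₀ hpos, hBI]
      exact hDP.trans_lt hlt
    · rintro hb _ ⟨I, hI, rfl⟩
      refine (hb ⟨I.toTypeDist hn, rfl⟩).trans ?_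
      obtain ⟨D, hD, hr⟩ := exists_tail I.r_antitone I.r_nonneg
      -- An optimal flow for the distributions of `I` covers every type at rate `θ`; weighting by
      -- `D` bounds `DP` from below.
      obtain ⟨x, y, hxy, hθ⟩ := (hmax (I.toTypeDist hn)).1
      change ∀ j : Fin I.m, _ at hθ
      rw [le_div_iff₀ hI]
      refine le_trans ?_ (I.coverage_le_DP hk hn hr hxy)
      rw [hB I D hD hr, Finset.mul_sum]
      refine Finset.sum_le_sum fun j _ => ?_
      have := mul_le_mul_of_nonneg_left (hθ j) (hD j)
      refine le_trans (le_of_eq ?_) this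
      simp only [Instance.toTypeDist]
      ring
  exact ⟨hlb ▸ hglb.1, hlb ▸ hglb.2⟩

end Conversion

end ProphetIneq

theorem mainTheorem8 (k n : ℕ) (hk : 1 ≤ k) (hn : k < n) :
    ((∀ G : ProphetIneq.TypeDist n, IsGreatest
        (ProphetIneq.feasibleTheta k G (G.prophQ k)) (ProphetIneq.innerLPProph k G)) ∧
      ∃ α : ℝ,
        IsGLB {ρ : ℝ | ∃ I : ProphetIneq.Instance k n, 0 < I.Proph ∧ ρ = I.DP / I.Proph} α ∧
        IsGLB (Set.range fun G : ProphetIneq.TypeDist n => ProphetIneq.innerLPProph k G) α) ∧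
    ((∀ G : ProphetIneq.TypeDist n, IsGreatest
        (ProphetIneq.feasibleTheta k G (G.exAnteQ k)) (ProphetIneq.innerLPExAnte k G)) ∧
      ∃ α : ℝ,
        IsGLB {ρ : ℝ | ∃ I : ProphetIneq.Instance k n, 0 < I.ExAnte ∧ ρ = I.DP / I.ExAnte} α ∧
        IsGLB (Set.range fun G : ProphetIneq.TypeDist n => ProphetIneq.innerLPExAnte k G) α) := by
  have hn0 : 0 < n := by omega
  have hk0 : (0 : ℝ) < k := by exact_mod_cast hk
  refine ⟨?_, ?_⟩
  · refine ProphetIneq.exists_isGLB_ratio_and_dual hk hn0 (ProphetIneq.expMinBer k) (fun g hg => ?_)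
      ProphetIneq.Instance.Proph fun I D hD hr => I.Proph_eq hn.le hD hr
    rwa [ProphetIneq.expMinBer_one hn.le hg]
  · refine ProphetIneq.exists_isGLB_ratio_and_dual hk hn0 (fun g => min (∑ i, g i) (k : ℝ)) (fun g hg => ?_)
      ProphetIneq.Instance.ExAnte fun I D hD hr => I.ExAnte_eq hn0 hD hr
    refine lt_min ?_ hk0
    simp [hg, hn0]
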